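/- **Conventions.** Let $n\ge 1$ and equip $\mathbb{R}^{2n}$ with the Euclidean norm and the standard symplectic form. For a sequence $\psi=(\psi_j)_{j\in\mathbb Z}$ of linear isomorphisms of $\mathbb{R}^{2n}$ write $$\Psi_{j,m}=\psi_{j+m-1}\circ\cdots\circ\psi_{j+1}\circ\psi_j ,$$ and let $$E^s_j(\psi)=\Bigl\{v:\ \sup_{k\ge 0}\|\Psi_{j,k+1}v\|<\infty\Bigr\},\qquad E^u_j(\psi)=\Bigl\{v:\ \sup_{k\ge 0}\|(\psi_{j-1}\circ\psi_{j-2}\circ\cdots\circ\psi_{j-1-k})^{-1}v\|<\infty\Bigr\}.$$ The sequence $\psi$ is *hyperbolic* if $E^s_j(\psi)\oplus E^u_j(\psi)=\mathbb{R}^{2n}$ for every $j\in\mathbb Z$, and *periodic* if for some integer $p>0$ one has $\psi_{j+p}=\psi_j$ for all $j$; the least such $p$ is its minimum period. Let $\{\psi^\alpha\}_{\alpha\in\Lambda}$ be a family of periodic sequences of symplectic isomorphisms of $\mathbb{R}^{2n}$, indexed by a set $\Lambda$. The family is *uniformly hyperbolic* if there is $\varepsilon>0$ such that, for every family $\{\eta^\alpha\}_{\alpha\in\Lambda}$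 of periodic sequences of symplectic isomorphisms of $\mathbb{R}^{2n}$ for which $\eta^\alpha$ and $\psi^\alpha$ have the same minimum period for every $\alpha\in\Lambda$ and $$d(\psi,\eta)=\sup_{\alpha\in\Lambda,\ j\in\mathbb Z}\|\psi^\alpha_j-\eta^\alpha_j\|<\varepsilon ,$$ every sequence $\eta^\alpha$ is hyperbolic. The family is *bounded* if $\sup_{\alpha,j}\|\psi^\alpha_j\|<\infty$. **Theorem.** Let $\{\psi^\alpha\}_{\alpha\in\Lambda}$ be a bounded, uniformly hyperbolic family of periodic sequences of symplectic isomorphisms of $\mathbb{R}^{2n}$, and write $\Psi^\alpha_{j,m}$ for the products $\Psi_{j,m}$ formed from $\psi^\alpha$. Then there exist constants $K>0$, an integer $m\ge 1$, and $\lambda\in(0,1)$ such that: 1. If $\alpha\in\Lambda$ and $\psi^\alpha$ has minimum period $p\ge m$, then, with $k=\lfloor p/m\rfloor$, $$\prod_{j=0}^{k-1}\bigl\|\Psi^\alpha_{mj,m}|_{E^s_{mj}(\psi^\alpha)}\bigr\|\le K\lambda^k\qquad\text{and}\qquad \prod_{j=0}^{k-1}\bigl\|(\Psi^\alpha_{mj,m})^{-1}|_{E^u_{m(j+1)}(\psi^\alpha)}\bigr\|\le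 K\lambda^k .$$ 2. For all $\alpha\in\Lambda$ and $j\in\mathbb Z$, $$\bigl\|\Psi^\alpha_{j,m}|_{E^s_{j}(\psi^\alpha)}\bigr\|\cdot\bigl\|(\Psi^\alpha_{j,m})^{-1}|_{E^u_{j+m}(\psi^\alpha)}\bigr\|\le\lambda .$$ 3. For every $\alpha\in\Lambda$, $$\limsup_{N\to+\infty}\frac1N\sum_{j=0}^{N-1}\ln\bigl\|\Psi^\alpha_{mj,m}|_{E^s_{mj}(\psi^\alpha)}\bigr\|<0\qquad\text{and}\qquad \limsup_{N\to+\infty}\frac1N\sum_{j=0}^{N-1}\ln\bigl\|(\Psi^\alpha_{mj,m})^{-1}|_{E^u_{m(j+1)}(\psi^\alpha)}\bigr\|<0 .$$ -/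

import Mathlib

noncomputable section

/-- The space `ℝ²ⁿ = ℝⁿ × ℝⁿ` with its Euclidean norm. -/
abbrev PhaseSpace (n : ℕ) : Type := EuclideanSpace ℝ (Fin n ⊕ Fin n)

/-- A linear isomorphism of `ℝ²ⁿ` is symplectic if its standard matrix is a symplectic matrix. -/
def IsSymplectic {n : ℕ} (A : PhaseSpace n ≃L[ℝ] PhaseSpace n) : Prop :=
  (Matrix.toEuclideanCLM (n := Fin n ⊕ Fin n) (𝕜 := ℝ)).symm
    (A : PhaseSpace n →L[ℝ] PhaseSpace n) ∈ Matrix.symplecticGroup (Fin n) ℝ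

section LinearSequences

variable {E : Type*} [NormedAddCommGroup E] [NormedSpace ℝ E]

/-- The block of length `m` starting at `j`, that is, the ordered product
`ψ (j + m - 1) ∘ ⋯ ∘ ψ (j + 1) ∘ ψ j` (the identity for `m = 0`). -/
def block (ψ : ℤ → (E ≃L[ℝ] E)) (j : ℤ) : ℕ → (E ≃L[ℝ] E)
  | 0 => ContinuousLinearEquiv.refl ℝ E
  | m + 1 => (block ψ j m).trans (ψ (j + m))

/-- The operator norm `‖A|_W‖` of the restriction of `A` to the subspace `W`. -/
def restrNorm (A : E →L[ℝ] E) (W : Submodule ℝ E) : ℝ := ‖A.comp W.subtypeL‖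

/-- The vectors whose iterates under a sequence of linear maps are bounded. -/
def boundedOrbitSubspace (T : ℕ → (E →L[ℝ] E)) : Submodule ℝ E where
  carrier := {v | BddAbove (Set.range fun k : ℕ => ‖T k v‖)}
  zero_mem' := ⟨0, by rintro _ ⟨k, rfl⟩; simp⟩
  add_mem' := by
    rintro v w ⟨a, ha⟩ ⟨b, hb⟩
    refine ⟨a + b, ?_⟩
    rintro _ ⟨k, rfl⟩
    simp only [map_add]
    exact (norm_add_le _ _).trans (add_le_add (ha ⟨k, rfl⟩) (hb ⟨k, rfl⟩))
  smul_mem' := by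
    rintro c v ⟨a, ha⟩
    refine ⟨‖c‖ * a, ?_⟩
    rintro _ ⟨k, rfl⟩
    simp only [map_smul, norm_smul]
    exact mul_le_mul_of_nonneg_left (ha ⟨k, rfl⟩) (norm_nonneg c)

/-- `Eˢ_j(ψ)`: the vectors `v` with `sup_{k ≥ 0} ‖ψ (j + k) ∘ ⋯ ∘ ψ j v‖ < ∞`. -/
def stableSubspace (ψ : ℤ → (E ≃L[ℝ] E)) (j : ℤ) : Submodule ℝ E :=
  boundedOrbitSubspace fun k => (block ψ j (k + 1) : E →L[ℝ] E)

/-- `Eᵘ_j(ψ)`: the vectors `v` with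
`sup_{k ≥ 0} ‖(ψ (j - 1) ∘ ⋯ ∘ ψ (j - 1 - k))⁻¹ v‖ < ∞`. -/
def unstableSubspace (ψ : ℤ → (E ≃L[ℝ] E)) (j : ℤ) : Submodule ℝ E :=
  boundedOrbitSubspace fun k => ((block ψ (j - 1 - k) (k + 1)).symm : E →L[ℝ] E)

/-- A sequence is hyperbolic if `Eˢ_j ⊕ Eᵘ_j` is the whole space for every `j`. -/
def IsHyperbolicSeq (ψ : ℤ → (E ≃L[ℝ] E)) : Prop :=
  ∀ j : ℤ, IsCompl (stableSubspace ψ j) (unstableSubspace ψ j)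

/-- A sequence is periodic if it has some period `p > 0`. -/
def IsPeriodicSeq (ψ : ℤ → (E ≃L[ℝ] E)) : Prop :=
  ∃ p : ℕ, 0 < p ∧ ∀ j : ℤ, ψ (j + p) = ψ j

/-- The minimum period of a periodic sequence. -/
def minPeriod (ψ : ℤ → (E ≃L[ℝ] E)) : ℕ :=
  sInf {p : ℕ | 0 < p ∧ ∀ j : ℤ, ψ (j + p) = ψ j}

/-- The (extended) distance `sup_{α, j} ‖ψ^α_j - η^α_j‖` between two families of sequences. -/
def familyDist {Λ : Type*} (ψ η : Λ → ℤ → (E ≃L[ℝ] E)) : ENNReal :=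
  ⨆ (α : Λ) (j : ℤ), ‖(ψ α j : E →L[ℝ] E) - (η α j : E →L[ℝ] E)‖ₑ

/-- Two families are periodically equivalent if corresponding sequences have the same minimum
period. -/
def PeriodicallyEquivalent {Λ : Type*} (ψ η : Λ → ℤ → (E ≃L[ℝ] E)) : Prop :=
  ∀ α : Λ, minPeriod (ψ α) = minPeriod (η α)

end LinearSequences

/-- A family of periodic sequences of symplectic isomorphisms of `ℝ²ⁿ`. -/
def IsPeriodicSymplecticFamily {Λ : Type*} {n : ℕ}
    (ψ : Λ → ℤ → (PhaseSpace n ≃L[ℝ] PhaseSpace n)) : Prop :=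
  (∀ α, IsPeriodicSeq (ψ α)) ∧ ∀ α j, IsSymplectic (ψ α j)

/-- Uniform hyperbolicity within the symplectic group: for some `ε > 0`, every periodically
equivalent family of periodic symplectic sequences at distance less than `ε` is hyperbolic. -/
def IsUniformlyHyperbolicFamily {Λ : Type*} {n : ℕ}
    (ψ : Λ → ℤ → (PhaseSpace n ≃L[ℝ] PhaseSpace n)) : Prop :=
  ∃ ε : ℝ, 0 < ε ∧ ∀ η : Λ → ℤ → (PhaseSpace n ≃L[ℝ] PhaseSpace n),
    IsPeriodicSymplecticFamily η → PeriodicallyEquivalent ψ η →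
    familyDist ψ η < ENNReal.ofReal ε → ∀ α, IsHyperbolicSeq (η α)

end

/-! The only perturbation needed is the symplectic rotation `R_t`, the Cayley transform of `tJ`,
composed with every `ψ^α_i`. For `|t| ≤ r` it moves the family by less than `ε` and keeps minimum
periods, so all twisted sequences are hyperbolic and have no nonzero bounded orbit.

On `N`-periodic sequences, `N` a multiple of the period, the operator `(Ux)_z = φ_z⁻¹ x_{z+1}`
preserves the summed symplectic form. Hence `J(U+1)(U-1)⁻¹` is symmetric. An eigenvalue larger than
`1/r` in modulus would yield a periodic orbit of a twisted sequence, so its norm is at most `1/r`.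
It follows that `r‖x‖ ≤ ‖Ux - x‖`, with `r` independent of `N` and `α`
(`norm_le_of_hyperbolic_twists`).

Testing this on a truncated orbit, where `Ux - x` lives at two sites, bounds the sum of squared
norms over a window by its two end values (`sum_sq_norm_block_le`). For bounded half-orbits this
forces geometric decay, so one `m` makes both restricted norms at most `1/2`. All three claims
follow with `K = 1`, `λ = 1/2`. -/

section TwistEstimate

/-! ### Symplectic maps and the norm of their Cayley transform. -/

variable {V : Type*} [NormedAddCommGroup V] [InnerProductSpace ℝ V]

lemma norm_apply_of_skew {J : V →ₗ[ℝ] V} (hskew : ∀ x y, inner ℝ (J x) y = -inner ℝ x (J y))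
    (hsq : ∀ x, J (J x) = -x) (x : V) : ‖J x‖ = ‖x‖ := by
  have h : ‖J x‖ ^ 2 = ‖x‖ ^ 2 := by
    rw [← real_inner_self_eq_norm_sq, ← real_inner_self_eq_norm_sq, hskew, hsq, inner_neg_right,
      neg_neg]
  exact (pow_left_inj₀ (norm_nonneg _) (norm_nonneg _) two_ne_zero).1 h

variable [FiniteDimensional ℝ V]

lemma norm_apply_le_of_abs_eigenvalue_le {A : V →ₗ[ℝ] V} (hA : A.IsSymmetric) {r : ℝ}
    (hr : 0 ≤ r) (h : ∀ (μ : ℝ) (w : V), w ≠ 0 → A w = μ • w → |μ| ≤ r) (w : V) :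
    ‖A w‖ ≤ r * ‖w‖ := by
  set b := hA.eigenvectorBasis rfl
  refine le_of_sq_le_sq ?_ (by positivity)
  rw [← b.sum_sq_norm_inner_right, mul_pow, ← b.sum_sq_norm_inner_right w, Finset.mul_sum]
  refine Finset.sum_le_sum fun i _ => ?_
  have hb : A (b i) = hA.eigenvalues rfl i • b i := hA.apply_eigenvectorBasis rfl i
  rw [← hA, hb, inner_smul_left, norm_mul, mul_pow]
  refine mul_le_mul_of_nonneg_right ?_ (by positivity)
  exact pow_le_pow_left₀ (norm_nonneg _) (h _ _ (b.orthonormal.ne_zero i) hb) 2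

/-- If no rotation `U x - x = t J (U x + x)` with `|t| ≤ r` has a nonzero solution, then the
Cayley transform of the symplectic map `U` is bounded by `1 / r`. -/
lemma norm_add_le_of_twist {J U : V →ₗ[ℝ] V}
    (hskew : ∀ x y, inner ℝ (J x) y = -inner ℝ x (J y)) (hsq : ∀ x, J (J x) = -x)
    (hU : ∀ x y, inner ℝ (J (U x)) (U y) = inner ℝ (J x) y) {r : ℝ} (hr : 0 < r)
    (hker : ∀ t : ℝ, |t| ≤ r → ∀ x, U x - x = t • J (U x + x) → x = 0) (x : V) :
    r * ‖U x + x‖ ≤ ‖U x - x‖ := by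
  -- The case `t = 0` of `hker` makes `U - 1` invertible.
  have hinj : Function.Injective (U - LinearMap.id : V →ₗ[ℝ] V) := by
    rw [← LinearMap.ker_eq_bot, LinearMap.ker_eq_bot']
    intro y hy
    exact hker 0 (by simpa using hr.le) y (by simpa using hy)
  set e := LinearEquiv.ofInjectiveEndo _ hinj
  have he : ∀ y, e y = U y - y := fun y => rfl
  set A : V →ₗ[ℝ] V := J ∘ₗ (U + LinearMap.id) ∘ₗ (e.symm : V →ₗ[ℝ] V)
  have hAe : ∀ y, A (U y - y) = J (U y + y) := fun y => by
    rw [← he]; simp [A]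
  -- With `v = Ua - a`, `w = Ub - b`, the terms `⟪JUa, Ub⟫` and `⟪Ja, b⟫` cancel by invariance of
  -- the form; the mixed terms agree by skewness of `J`.
  have hA : A.IsSymmetric := by
    intro v w
    obtain ⟨a, rfl⟩ := e.surjective v
    obtain ⟨b, rfl⟩ := e.surjective w
    simp only [he, hAe]
    have h1 := hU a b
    have h2 := hskew (U a - a) (U b + b)
    simp only [map_add, map_sub, inner_add_left, inner_sub_left, inner_add_right,
      inner_sub_right] at h2 ⊢
    linarith
  -- An eigenvalue `μ` of `A` solves the twist equation with `t = μ⁻¹`, so `|μ| > 1/r` is excluded.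
  have hbound : ∀ (μ : ℝ) (w : V), w ≠ 0 → A w = μ • w → |μ| ≤ r⁻¹ := by
    intro μ w hw hμ
    obtain ⟨y, rfl⟩ := e.surjective w
    by_contra! hlt
    have hμ0 : 0 < |μ| := (inv_pos.2 hr).trans hlt
    refine hw ?_
    have hy : y = 0 := by
      refine hker μ⁻¹ ?_ y ?_
      · rw [abs_inv]
        exact (inv_lt_of_inv_lt₀ hr hlt).le
      · rw [he, hAe] at hμ
        rw [hμ, smul_smul, inv_mul_cancel₀ (abs_pos.1 hμ0), one_smul]
    rw [hy, map_zero]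
  have h := norm_apply_le_of_abs_eigenvalue_le hA (inv_nonneg.2 hr.le) hbound (U x - x)
  rw [hAe, norm_apply_of_skew hskew hsq] at h
  calc r * ‖U x + x‖ ≤ r * (r⁻¹ * ‖U x - x‖) := by gcongr
    _ = ‖U x - x‖ := by rw [← mul_assoc, mul_inv_cancel₀ hr.ne', one_mul]

end TwistEstimate

/-! ### Geometric decay from window sums. -/

section Decay

/-- A bounded sequence whose sums over windows are controlled by the end values decays
geometrically. -/
lemma geometric_decay_of_window_sums {a : ℕ → ℝ} (ha : ∀ k, 0 ≤ a k) {B : ℝ}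
    (hB : ∀ k, a k ≤ B) {Q : ℝ} (hQ : 1 ≤ Q)
    (hsum : ∀ i M, ∑ k ∈ Finset.range (M + 1), a (i + k) ≤ Q * (a i + a (i + M))) (m : ℕ) :
    a m ≤ Q * (1 - Q⁻¹) ^ m * a 0 := by
  have hQ0 : 0 < Q := by linarith
  have hsummable : Summable a := by
    refine summable_of_sum_range_le (c := Q * (B + B)) ha fun N => ?_
    calc ∑ k ∈ Finset.range N, a k ≤ ∑ k ∈ Finset.range (N + 1), a k :=
          Finset.sum_le_sum_of_subset_of_nonneg
            (Finset.range_mono (Nat.le_succ N)) fun k _ _ => ha k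
      _ ≤ Q * (a 0 + a N) := by simpa using hsum 0 N
      _ ≤ Q * (B + B) := by gcongr <;> apply hB
  have hlim := hsummable.tendsto_atTop_zero
  set s : ℕ → ℝ := fun i => ∑' k, a (k + i)
  have hs : ∀ i, Summable fun k => a (k + i) := fun i => (summable_nat_add_iff i).2 hsummable
  -- Summability sends the far end value to zero, so only the near one bounds the tail.
  have hsQ : ∀ i, s i ≤ Q * a i := by
    intro i
    have h1 : Filter.Tendsto (fun M => ∑ k ∈ Finset.range (M + 1), a (k + i)) Filter.atTop
        (nhds (s i)) := (hs i).hasSum.tendsto_sum_nat.comp (Filter.tendsto_add_atTop_nat 1)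
    have h2 : Filter.Tendsto (fun M => Q * (a i + a (M + i))) Filter.atTop
        (nhds (Q * (a i + 0))) :=
      ((hlim.comp (Filter.tendsto_add_atTop_nat i)).const_add _).const_mul _
    rw [add_zero] at h2
    refine le_of_tendsto_of_tendsto' h1 h2 fun M => ?_
    simpa only [add_comm] using hsum i M
  have hstep : ∀ i, s i = a i + s (i + 1) := by
    intro i
    have := (hs i).tsum_eq_zero_add
    simp only [zero_add] at this
    simp only [s, this, add_assoc, add_comm 1 i]
  have has : ∀ i, a i ≤ s i := fun i => by
    have : 0 ≤ s (i + 1) := tsum_nonneg fun k => ha _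
    linarith [hstep i]
  have hq : 0 ≤ 1 - Q⁻¹ := by linarith [inv_le_one_of_one_le₀ hQ]
  -- `s i ≤ Q * a i` and `s i = a i + s (i + 1)` shrink each tail by the factor `1 - Q⁻¹`.
  have hpow : ∀ i, s i ≤ (1 - Q⁻¹) ^ i * s 0 := by
    intro i
    induction i with
    | zero => simp
    | succ i ih =>
      have h1 : Q⁻¹ * s i ≤ a i := by
        rw [inv_mul_le_iff₀ hQ0]; exact hsQ i
      calc s (i + 1) ≤ (1 - Q⁻¹) * s i := by linarith [hstep i]
        _ ≤ (1 - Q⁻¹) * ((1 - Q⁻¹) ^ i * s 0) := by gcongr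
        _ = _ := by ring
  calc a m ≤ (1 - Q⁻¹) ^ m * s 0 := (has m).trans (hpow m)
    _ ≤ (1 - Q⁻¹) ^ m * (Q * a 0) := by gcongr; exact hsQ 0
    _ = _ := by ring

end Decay

noncomputable section

/-! ### Orbits of linear sequences and Cayley rotations. -/

section Orbits

variable {E : Type*} [NormedAddCommGroup E] [NormedSpace ℝ E]

lemma block_zero_apply (ψ : ℤ → (E ≃L[ℝ] E)) (j : ℤ) (v : E) : block ψ j 0 v = v := rfl

lemma block_succ_apply (ψ : ℤ → (E ≃L[ℝ] E)) (j : ℤ) (m : ℕ) (v : E) :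
    block ψ j (m + 1) v = ψ (j + m) (block ψ j m v) := rfl

lemma block_add_apply (ψ : ℤ → (E ≃L[ℝ] E)) (j : ℤ) (i k : ℕ) (v : E) :
    block ψ j (i + k) v = block ψ (j + i) k (block ψ j i v) := by
  induction k with
  | zero => rfl
  | succ k ih =>
    rw [← add_assoc, block_succ_apply, ih, block_succ_apply]
    push_cast
    rw [add_assoc]

lemma block_apply_orbit {ψ : ℤ → (E ≃L[ℝ] E)} {y : ℤ → E} (hy : ∀ i, y (i + 1) = ψ i (y i))
    (j : ℤ) (k : ℕ) : block ψ j k (y j) = y (j + k) := by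
  induction k with
  | zero => simp [block_zero_apply]
  | succ k ih =>
    rw [block_succ_apply, ih, ← hy]
    push_cast
    rw [add_assoc]

/-- A bounded two-sided orbit lies in both the stable and the unstable subspace. -/
lemma IsHyperbolicSeq.eq_zero_of_bounded_orbit {ψ : ℤ → (E ≃L[ℝ] E)} (h : IsHyperbolicSeq ψ)
    {y : ℤ → E} (hy : ∀ i, y (i + 1) = ψ i (y i)) {B : ℝ} (hB : ∀ i, ‖y i‖ ≤ B) (j : ℤ) :
    y j = 0 := by
  refine (Submodule.disjoint_def.1 (h j).disjoint) _ ⟨B, ?_⟩ ⟨B, ?_⟩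
  · rintro _ ⟨k, rfl⟩
    have := block_apply_orbit hy j (k + 1)
    simpa [this] using hB _
  · rintro _ ⟨k, rfl⟩
    have : (block ψ (j - 1 - k) (k + 1)).symm (y j) = y (j - 1 - k) := by
      rw [ContinuousLinearEquiv.symm_apply_eq, block_apply_orbit hy]
      congr 1
      push_cast
      ring
    simpa [this] using hB _

lemma block_shift (ψ : ℤ → (E ≃L[ℝ] E)) (j i : ℤ) (k : ℕ) :
    block (fun i => ψ (j + i)) i k = block ψ (j + i) k := by
  induction k with
  | zero => rfl
  | succ k ih => simp only [block, ih, add_assoc]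

lemma IsHyperbolicSeq.shift {ψ : ℤ → (E ≃L[ℝ] E)} (h : IsHyperbolicSeq ψ) (j : ℤ) :
    IsHyperbolicSeq fun i => ψ (j + i) := by
  intro i
  have := h (j + i)
  simpa only [stableSubspace, unstableSubspace, block_shift, add_sub_assoc] using this

/-- The Cayley transform `(1 + tJ)(1 - tJ)⁻¹` of `tJ`, where `J² = -1`. -/
def cayleyRotation (J : E →L[ℝ] E) (hsq : ∀ x, J (J x) = -x) (t : ℝ) : E ≃L[ℝ] E :=
  ContinuousLinearEquiv.equivOfInverse
    (((1 - t ^ 2) / (1 + t ^ 2)) • ContinuousLinearMap.id ℝ E + (2 * t / (1 + t ^ 2)) • J)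
    (((1 - t ^ 2) / (1 + t ^ 2)) • ContinuousLinearMap.id ℝ E - (2 * t / (1 + t ^ 2)) • J)
    (fun x => by
      have h : 1 + t ^ 2 ≠ 0 := by positivity
      simp only [add_apply, _root_.sub_apply,
        _root_.smul_apply, ContinuousLinearMap.id_apply, map_add, map_smul, hsq]
      match_scalars <;> field_simp <;> ring)
    (fun x => by
      have h : 1 + t ^ 2 ≠ 0 := by positivity
      simp only [add_apply, _root_.sub_apply,
        _root_.smul_apply, ContinuousLinearMap.id_apply, map_sub, map_smul, hsq]
      match_scalars <;> field_simp <;> ring)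

lemma coe_cayleyRotation (J : E →L[ℝ] E) (hsq : ∀ x, J (J x) = -x) (t : ℝ) :
    (cayleyRotation J hsq t : E →L[ℝ] E) =
      ((1 - t ^ 2) / (1 + t ^ 2)) • ContinuousLinearMap.id ℝ E + (2 * t / (1 + t ^ 2)) • J :=
  rfl

lemma cayleyRotation_apply (J : E →L[ℝ] E) (hsq : ∀ x, J (J x) = -x) (t : ℝ) (x : E) :
    cayleyRotation J hsq t x =
      ((1 - t ^ 2) / (1 + t ^ 2)) • x + (2 * t / (1 + t ^ 2)) • J x := rfl

/-- The hypothesis reads `(1 - tJ)u = (1 + tJ)x`, and `1 - tJ` is invertible since `(1 + tJ)(1 - tJ)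
= 1 + t²`. -/
lemma eq_cayleyRotation_apply (J : E →L[ℝ] E) (hsq : ∀ x, J (J x) = -x) {t : ℝ} {u x : E}
    (h : u - x = t • J (u + x)) : u = cayleyRotation J hsq t x := by
  have ht : 1 + t ^ 2 ≠ 0 := by positivity
  have h2 := congrArg J h
  rw [map_sub, map_smul, hsq] at h2
  have h3 : J u = J x - t • (u + x) := by
    rw [sub_eq_iff_eq_add] at h2
    rw [h2]; module
  have h4 : (1 + t ^ 2) • u = (1 - t ^ 2) • x + (2 * t) • J x := by
    rw [sub_eq_iff_eq_add, map_add, h3] at h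
    calc (1 + t ^ 2) • u = u + t ^ 2 • u := by module
      _ = t • (J x - t • (u + x) + J x) + x + t ^ 2 • u := by rw [← h]
      _ = _ := by module
  rw [cayleyRotation_apply, ← inv_smul_smul₀ ht u, h4]
  match_scalars <;> field_simp

end Orbits

/-! ### The shift operator on periodic sequences. -/

section PeriodicSequences

variable {E : Type*} [NormedAddCommGroup E] [InnerProductSpace ℝ E]

/-- The map acting on each entry of an `N`-periodic sequence. -/
def entrywise (N : ℕ) [NeZero N] (J : E →L[ℝ] E) :
    PiLp 2 (fun _ : ZMod N => E) →ₗ[ℝ] PiLp 2 (fun _ : ZMod N => E) where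
  toFun x := WithLp.toLp 2 fun z => J (x z)
  map_add' x y := by ext z; simp
  map_smul' c x := by ext z; simp

/-- The map `(U x)_z = φ_z⁻¹ x_{z + 1}` on `N`-periodic sequences. -/
def pullbackShift (N : ℕ) [NeZero N] (φ : ZMod N → (E ≃L[ℝ] E)) :
    PiLp 2 (fun _ : ZMod N => E) →ₗ[ℝ] PiLp 2 (fun _ : ZMod N => E) where
  toFun x := WithLp.toLp 2 fun z => (φ z).symm (x (z + 1))
  map_add' x y := by ext z; simp
  map_smul' c x := by ext z; simp

variable [FiniteDimensional ℝ E]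

/-- The shift operator preserves the entrywise symplectic form, so `norm_add_le_of_twist` applies to
it. The point is that the constant `r` does not depend on `N`. -/
lemma norm_le_of_hyperbolic_twists {J : E →L[ℝ] E}
    (hskew : ∀ x y, inner ℝ (J x) y = -inner ℝ x (J y)) (hsq : ∀ x, J (J x) = -x)
    {N : ℕ} [NeZero N] {φ : ZMod N → (E ≃L[ℝ] E)}
    (hφ : ∀ z x y, inner ℝ (J (φ z x)) (φ z y) = inner ℝ (J x) y)
    {r : ℝ} (hr : 0 < r) (hr1 : r ≤ 1)
    (hhyp : ∀ t : ℝ, |t| ≤ r →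
      IsHyperbolicSeq fun i : ℤ => (cayleyRotation J hsq t).trans (φ (i : ZMod N)))
    (x : PiLp 2 (fun _ : ZMod N => E)) :
    r * ‖x‖ ≤ ‖pullbackShift N φ x - x‖ := by
  set U := pullbackShift N φ
  have hUz : ∀ x z, U x z = (φ z).symm (x (z + 1)) := fun _ _ => rfl
  have hJz : ∀ x z, entrywise N J x z = J (x z) := fun _ _ => rfl
  have key : r * ‖U x + x‖ ≤ ‖U x - x‖ := by
    refine norm_add_le_of_twist (J := entrywise N J) ?_ ?_ ?_ hr ?_ x
    · intro x y
      simp only [PiLp.inner_apply, hJz, hskew, Finset.sum_neg_distrib]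
    · intro x
      ext z
      simp [hJz, hsq]
    · intro x y
      simp only [PiLp.inner_apply, hJz, hUz]
      rw [← Equiv.sum_comp (Equiv.addRight (1 : ZMod N)) fun z => inner ℝ (J (x z)) (y z)]
      refine Finset.sum_congr rfl fun z _ => ?_
      simp [← hφ z ((φ z).symm _)]
    -- The twist equation says entrywise that `y` is an `N`-periodic, hence bounded, orbit of the
    -- twisted sequence.
    · intro t ht y hy
      have hrot : ∀ z, (φ z).symm (y (z + 1)) = cayleyRotation J hsq t (y z) := by
        intro z
        refine eq_cayleyRotation_apply J hsq ?_
        simpa [hUz, hJz] using congrArg (fun w => w z) hy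
      have horb : ∀ i : ℤ, y ((i + 1 : ℤ) : ZMod N) =
          ((cayleyRotation J hsq t).trans (φ (i : ZMod N))) (y (i : ZMod N)) := by
        intro i
        rw [ContinuousLinearEquiv.trans_apply, ← hrot]
        simp
      have hzero := (hhyp t ht).eq_zero_of_bounded_orbit (y := fun i : ℤ => y (i : ZMod N))
        horb (B := ‖y‖) fun i => PiLp.norm_apply_le y _
      ext z
      have := hzero (z.val : ℤ)
      simpa using this
  -- `2r‖x‖ ≤ r‖Ux + x‖ + r‖Ux - x‖ ≤ 2‖Ux - x‖`, where `r ≤ 1` handles the second term.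
  have h2 : (2 : ℝ) • x = (U x + x) - (U x - x) := by module
  have h3 : 2 * ‖x‖ ≤ ‖U x + x‖ + ‖U x - x‖ := by
    have := norm_sub_le (U x + x) (U x - x)
    rw [← h2, norm_smul] at this
    simpa using this
  nlinarith [norm_nonneg (U x - x), norm_nonneg x]

lemma ZMod.sum_eq_sum_range {M : Type*} [AddCommMonoid M] (N : ℕ) [NeZero N] (F : ZMod N → M) :
    ∑ z, F z = ∑ i ∈ Finset.range N, F (i : ZMod N) := by
  obtain ⟨N, rfl⟩ := Nat.exists_eq_succ_of_ne_zero (NeZero.ne N)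
  rw [← Fin.sum_univ_eq_sum_range (fun i => F (i : ZMod (N + 1))) (N + 1)]
  exact Finset.sum_congr rfl fun z _ => by congr 1; exact (ZMod.natCast_zmod_val z).symm

/-- Apply the previous bound to the orbit of `v` cut off after time `M`: being an orbit, it is
annihilated by `U - 1` except where it starts and where it is cut. -/
lemma sum_sq_norm_block_le {J : E →L[ℝ] E}
    (hskew : ∀ x y, inner ℝ (J x) y = -inner ℝ x (J y)) (hsq : ∀ x, J (J x) = -x)
    {ψ : ℤ → (E ≃L[ℝ] E)} (hψ : ∀ i x y, inner ℝ (J (ψ i x)) (ψ i y) = inner ℝ (J x) y)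
    (hper : IsPeriodicSeq ψ) {C : ℝ} (hC : ∀ i v, ‖(ψ i).symm v‖ ≤ C * ‖v‖)
    {r : ℝ} (hr : 0 < r) (hr1 : r ≤ 1)
    (hhyp : ∀ t : ℝ, |t| ≤ r →
      IsHyperbolicSeq fun i : ℤ => (cayleyRotation J hsq t).trans (ψ i))
    (j : ℤ) (M : ℕ) (v : E) :
    r ^ 2 * ∑ k ∈ Finset.range (M + 1), ‖block ψ j k v‖ ^ 2 ≤
      C ^ 2 * ‖v‖ ^ 2 + ‖block ψ j M v‖ ^ 2 := by
  obtain ⟨p, hp, hper⟩ := hper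
  -- A multiple of the period with `N - 1 > M`, so that the two defect sites `N - 1` and `M` are
  -- distinct.
  set N := p * (M + 2) with hN
  have hMN : M + 2 ≤ N := Nat.le_mul_of_pos_left _ hp
  have : NeZero N := ⟨by omega⟩
  set φ : ZMod N → (E ≃L[ℝ] E) := fun z => ψ (j + z.val)
  have hφ : ∀ i : ℤ, φ (i : ZMod N) = ψ (j + i) := by
    intro i
    have h1 : Function.Periodic ψ (p : ℤ) := hper
    have h2 := h1.int_mul ((M + 2 : ℕ) * (i / N)) (j + i % N)
    simp only [φ, ZMod.val_intCast]
    rw [← h2]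
    congr 1
    have := Int.emod_add_mul_ediv i N
    rw [add_assoc]
    congr 1
    conv_rhs => rw [← this]
    rw [hN]
    push_cast
    ring
  have hcast : ∀ i : ℕ, i < N → ((i : ZMod N)).val = i := fun i hi => ZMod.val_cast_of_lt hi
  set x : PiLp 2 (fun _ : ZMod N => E) :=
    WithLp.toLp 2 fun z => if z.val ≤ M then block ψ j z.val v else 0
  have hx : ∀ i : ℕ, i < N → x (i : ZMod N) = if i ≤ M then block ψ j i v else 0 := by
    intro i hi
    simp only [x, hcast i hi]
  have hmain := norm_le_of_hyperbolic_twists hskew hsq (φ := φ) (fun z => hψ _) hr hr1 ?_ x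
  swap
  · intro t ht
    simpa only [hφ] using (hhyp t ht).shift j
  have hsum1 : ‖x‖ ^ 2 = ∑ k ∈ Finset.range (M + 1), ‖block ψ j k v‖ ^ 2 := by
    rw [PiLp.norm_sq_eq_of_L2, ZMod.sum_eq_sum_range]
    symm
    refine Finset.sum_subset_zero_on_sdiff (Finset.range_mono (by omega)) ?_ ?_
    · intro i hi
      simp only [Finset.mem_sdiff, Finset.mem_range] at hi
      rw [hx i hi.1, if_neg (by omega)]
      simp
    · intro i hi
      rw [Finset.mem_range] at hi
      rw [hx i (by omega), if_pos (by omega)]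
  have hsum2 : ‖pullbackShift N φ x - x‖ ^ 2 ≤ C ^ 2 * ‖v‖ ^ 2 + ‖block ψ j M v‖ ^ 2 := by
    rw [PiLp.norm_sq_eq_of_L2, ZMod.sum_eq_sum_range]
    have hterm : ∀ i ∈ Finset.range N,
        ‖(pullbackShift N φ x - x) (i : ZMod N)‖ ^ 2 ≤
          (if i = N - 1 then C ^ 2 * ‖v‖ ^ 2 else 0) +
            (if i = M then ‖block ψ j M v‖ ^ 2 else 0) := by
      intro i hi
      rw [Finset.mem_range] at hi
      have happ : (pullbackShift N φ x - x) (i : ZMod N) =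
          (φ (i : ZMod N)).symm (x ((i : ZMod N) + 1)) - x (i : ZMod N) := rfl
      rw [happ, hx i hi]
      -- Site `N - 1` wraps around to `x_0 = v` and contributes `φ⁻¹ v`; site `M` contributes the
      -- discarded end value.
      by_cases hi1 : i = N - 1
      · have h0 : ((i : ZMod N) + 1) = ((0 : ℕ) : ZMod N) := by
          have : ((i + 1 : ℕ) : ZMod N) = ((N : ℕ) : ZMod N) := by congr 1; omega
          simpa using this
        rw [h0, hx 0 (by omega), if_pos (Nat.zero_le _), if_neg (by omega), if_pos hi1,
          if_neg (by omega), block_zero_apply, sub_zero, add_zero, ← mul_pow]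
        exact pow_le_pow_left₀ (norm_nonneg _) (hC _ _) 2
      · have h1 : ((i : ZMod N) + 1) = ((i + 1 : ℕ) : ZMod N) := by push_cast; rfl
        have h2 := hφ i
        rw [Int.cast_natCast] at h2
        rw [h1, hx (i + 1) (by omega), if_neg hi1, zero_add, h2]
        rcases lt_trichotomy i M with h | h | h
        · rw [if_pos (by omega), if_pos h.le, if_neg h.ne, block_succ_apply]
          simp
        · subst h
          simp
        · rw [if_neg (by omega), if_neg (by omega), if_neg (by omega)]
          simp
    refine (Finset.sum_le_sum hterm).trans ?_
    rw [Finset.sum_add_distrib, Finset.sum_ite_eq', Finset.sum_ite_eq',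
      if_pos (Finset.mem_range.2 (by omega)), if_pos (Finset.mem_range.2 (by omega))]
  rw [← hsum1, ← mul_pow]
  exact (pow_le_pow_left₀ (by positivity) hmain 2).trans hsum2

end PeriodicSequences

end

noncomputable section

/-! ### Decay on stable and unstable subspaces, and operator bounds. -/

section WindowBounds

variable {E : Type*} [NormedAddCommGroup E] [NormedSpace ℝ E]

lemma sq_norm_block_le_of_mem_stableSubspace {ψ : ℤ → (E ≃L[ℝ] E)} {Q : ℝ} (hQ : 1 ≤ Q)
    (hwin : ∀ (j : ℤ) (M : ℕ) (v : E), ∑ k ∈ Finset.range (M + 1), ‖block ψ j k v‖ ^ 2 ≤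
      Q * (‖v‖ ^ 2 + ‖block ψ j M v‖ ^ 2))
    {j : ℤ} {v : E} (hv : v ∈ stableSubspace ψ j) (m : ℕ) :
    ‖block ψ j m v‖ ^ 2 ≤ Q * (1 - Q⁻¹) ^ m * ‖v‖ ^ 2 := by
  obtain ⟨B, hB⟩ := hv
  -- The orbit bound `B` starts at time one; time zero is covered by `‖v‖`.
  refine geometric_decay_of_window_sums (a := fun k => ‖block ψ j k v‖ ^ 2)
    (fun k => by positivity) (B := max ‖v‖ B ^ 2) ?_ hQ ?_ m
  · rintro (_ | k)
    · exact pow_le_pow_left₀ (norm_nonneg _) (le_max_left _ _) 2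
    · exact pow_le_pow_left₀ (norm_nonneg _) ((hB ⟨k, rfl⟩).trans (le_max_right _ _)) 2
  · intro i M
    simpa only [block_add_apply] using hwin (j + i) M (block ψ j i v)

/-- The window inequality is symmetric in its two end values, so it also applies to orbits read
backward. -/
lemma sq_norm_block_symm_le_of_mem_unstableSubspace {ψ : ℤ → (E ≃L[ℝ] E)} {Q : ℝ} (hQ : 1 ≤ Q)
    (hwin : ∀ (j : ℤ) (M : ℕ) (v : E), ∑ k ∈ Finset.range (M + 1), ‖block ψ j k v‖ ^ 2 ≤
      Q * (‖v‖ ^ 2 + ‖block ψ j M v‖ ^ 2))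
    {j : ℤ} {v : E} (hv : v ∈ unstableSubspace ψ j) (m : ℕ) :
    ‖(block ψ (j - m) m).symm v‖ ^ 2 ≤ Q * (1 - Q⁻¹) ^ m * ‖v‖ ^ 2 := by
  obtain ⟨B, hB⟩ := hv
  have hdecay := geometric_decay_of_window_sums
    (a := fun k : ℕ => ‖(block ψ (j - k) k).symm v‖ ^ 2)
    (fun k => by positivity) (B := max ‖v‖ B ^ 2) ?_ hQ ?_ m
  · simpa [block] using hdecay
  · rintro (_ | k)
    · exact pow_le_pow_left₀ (norm_nonneg _) (le_max_left _ _) 2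
    · refine pow_le_pow_left₀ (norm_nonneg _) (le_trans ?_ (le_max_right ‖v‖ B)) 2
      have := hB ⟨k, rfl⟩
      have hidx : j - ((k + 1 : ℕ) : ℤ) = j - 1 - k := by push_cast; ring
      rw [hidx]
      exact this
  · intro i M
    -- The earliest point of the backward window; its forward orbit runs through the window in
    -- reverse.
    set w := (block ψ (j - (i + M : ℕ)) (i + M)).symm v with hw
    have hback : ∀ k ≤ M, block ψ (j - (i + M : ℕ)) k w =
        (block ψ (j - (i + (M - k) : ℕ)) (i + (M - k))).symm v := by
      intro k hk
      rw [ContinuousLinearEquiv.eq_symm_apply]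
      have h1 : j - (i + (M - k) : ℕ) = j - (i + M : ℕ) + k := by
        push_cast [Nat.cast_sub hk]; ring
      have h2 : i + M = k + (i + (M - k)) := by omega
      rw [h1, ← block_add_apply, ← h2, hw, ContinuousLinearEquiv.apply_symm_apply]
    have h := hwin (j - (i + M : ℕ)) M w
    rw [hback M le_rfl, Nat.sub_self, add_zero, add_comm (‖w‖ ^ 2)] at h
    refine le_trans (le_of_eq ?_) h
    rw [← Finset.sum_range_reflect]
    refine Finset.sum_congr rfl fun k hk => ?_
    rw [Finset.mem_range] at hk
    have : M + 1 - 1 - k = M - k := by omega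
    rw [hback k (by omega), this]

lemma restrNorm_le_of_sq_le {A : E →L[ℝ] E} {W : Submodule ℝ E} {c : ℝ} (hc : 0 ≤ c)
    (h : ∀ v ∈ W, ‖A v‖ ^ 2 ≤ c ^ 2 * ‖v‖ ^ 2) : restrNorm A W ≤ c := by
  refine ContinuousLinearMap.opNorm_le_bound _ hc fun v => ?_
  have := h v v.2
  rw [← mul_pow] at this
  exact le_of_sq_le_sq this (by positivity)

lemma norm_apply_le_restrNorm (A : E →L[ℝ] E) {W : Submodule ℝ E} {v : E} (hv : v ∈ W) :
    ‖A v‖ ≤ restrNorm A W * ‖v‖ :=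
  (A.comp W.subtypeL).le_opNorm ⟨v, hv⟩

lemma norm_block_le {ψ : ℤ → (E ≃L[ℝ] E)} {C : ℝ} (hC0 : 0 ≤ C) (hC : ∀ i v, ‖ψ i v‖ ≤ C * ‖v‖)
    (j : ℤ) (m : ℕ) (v : E) : ‖block ψ j m v‖ ≤ C ^ m * ‖v‖ := by
  induction m with
  | zero => simp [block_zero_apply]
  | succ m ih =>
    rw [block_succ_apply, pow_succ', mul_assoc]
    exact (hC _ _).trans (mul_le_mul_of_nonneg_left ih hC0)

lemma norm_block_symm_le {ψ : ℤ → (E ≃L[ℝ] E)} {C : ℝ} (hC0 : 0 ≤ C)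
    (hC : ∀ i v, ‖(ψ i).symm v‖ ≤ C * ‖v‖) (j : ℤ) (m : ℕ) (v : E) :
    ‖(block ψ j m).symm v‖ ≤ C ^ m * ‖v‖ := by
  induction m generalizing v with
  | zero => simp [block]
  | succ m ih =>
    have : (block ψ j (m + 1)).symm v = (block ψ j m).symm ((ψ (j + m)).symm v) := rfl
    rw [this, pow_succ, mul_assoc]
    exact (ih _).trans (mul_le_mul_of_nonneg_left (hC _ _) (by positivity))

end WindowBounds

/-! ### Averages of logarithms. -/

section Averages

/-- Each average is at most `log l < 0`. The lower bound `b` keeps the averages bounded below, so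
the real `limsup` is meaningful, and avoids the default value `log 0 = 0`. -/
lemma limsup_average_log_neg {a : ℕ → ℝ} {b l : ℝ} (hb : 0 < b) (hl : l < 1)
    (hba : ∀ j, b ≤ a j) (hal : ∀ j, a j ≤ l) :
    Filter.limsup (fun N : ℕ => (1 / (N : ℝ)) * ∑ j ∈ Finset.range N, Real.log (a j))
      Filter.atTop < 0 := by
  have hl0 : 0 < l := hb.trans_le ((hba 0).trans (hal 0))
  refine lt_of_le_of_lt (Filter.limsup_le_of_le ?_ ?_) (Real.log_neg hl0 hl)
  · refine Filter.IsCoboundedUnder.of_frequently_ge (a := Real.log b) ?_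
    refine ((Filter.eventually_gt_atTop 0).mono fun N hN => ?_).frequently
    have hN' : (0 : ℝ) < N := by exact_mod_cast hN
    rw [one_div, le_inv_mul_iff₀ hN', ← nsmul_eq_mul]
    simpa using Finset.card_nsmul_le_sum (Finset.range N) (fun j => Real.log (a j)) _
      fun j _ => Real.log_le_log hb (hba j)
  · filter_upwards [Filter.eventually_gt_atTop 0] with N hN
    have hN' : (0 : ℝ) < N := by exact_mod_cast hN
    rw [one_div, inv_mul_le_iff₀ hN', ← nsmul_eq_mul]
    simpa using Finset.sum_le_card_nsmul (Finset.range N) (fun j => Real.log (a j)) _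
      fun j _ => Real.log_le_log (hb.trans_le (hba j)) (hal j)

end Averages

/-! ### The standard symplectic structure. -/

section Symplectic

variable {n : ℕ}

/-- The standard complex structure on `ℝ²ⁿ`. -/
def complexStructure (n : ℕ) : PhaseSpace n →L[ℝ] PhaseSpace n :=
  Matrix.toEuclideanCLM (n := Fin n ⊕ Fin n) (𝕜 := ℝ) (Matrix.J (Fin n) ℝ)

lemma complexStructure_sq (x : PhaseSpace n) :
    complexStructure n (complexStructure n x) = -x := by
  rw [← mul_apply_eq_comp, complexStructure, ← map_mul, Matrix.J_squared]
  simp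

lemma toEuclideanCLM_transpose (A : Matrix (Fin n ⊕ Fin n) (Fin n ⊕ Fin n) ℝ) :
    Matrix.toEuclideanCLM (n := Fin n ⊕ Fin n) (𝕜 := ℝ) A.transpose =
      ContinuousLinearMap.adjoint (Matrix.toEuclideanCLM (n := Fin n ⊕ Fin n) (𝕜 := ℝ) A) := by
  rw [← ContinuousLinearMap.star_eq_adjoint, ← map_star, Matrix.star_eq_conjTranspose,
    Matrix.conjTranspose_eq_transpose_of_trivial]

lemma complexStructure_skew (x y : PhaseSpace n) :
    inner ℝ (complexStructure n x) y = -inner ℝ x (complexStructure n y) := by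
  rw [← ContinuousLinearMap.adjoint_inner_left, complexStructure, ← toEuclideanCLM_transpose,
    Matrix.J_transpose, map_neg, _root_.neg_apply, inner_neg_left, neg_neg]

lemma norm_complexStructure_apply (x : PhaseSpace n) : ‖complexStructure n x‖ = ‖x‖ :=
  norm_apply_of_skew (J := (complexStructure n : PhaseSpace n →ₗ[ℝ] PhaseSpace n))
    complexStructure_skew complexStructure_sq x

lemma IsSymplectic.inner_complexStructure {A : PhaseSpace n ≃L[ℝ] PhaseSpace n}
    (hA : IsSymplectic A) (x y : PhaseSpace n) :
    inner ℝ (complexStructure n (A x)) (A y) = inner ℝ (complexStructure n x) y := by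
  have h := congrArg (Matrix.toEuclideanCLM (n := Fin n ⊕ Fin n) (𝕜 := ℝ))
    (SymplecticGroup.mem_iff'.1 hA)
  rw [map_mul, map_mul, toEuclideanCLM_transpose, StarAlgEquiv.apply_symm_apply] at h
  have hx := congrArg (fun T : PhaseSpace n →L[ℝ] PhaseSpace n => inner ℝ (T x) y) h
  simpa [mul_apply_eq_comp, ContinuousLinearMap.adjoint_inner_left,
    complexStructure] using hx

/-- The inverse is no larger than the map: with `w = A⁻¹ v`, invariance gives `‖w‖² = ⟪Jv, AJw⟫ ≤
C‖v‖‖w‖`. -/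
lemma norm_symm_apply_le {A : PhaseSpace n ≃L[ℝ] PhaseSpace n} (hA : IsSymplectic A)
    {C : ℝ} (hC : ‖(A : PhaseSpace n →L[ℝ] PhaseSpace n)‖ ≤ C) (v : PhaseSpace n) :
    ‖A.symm v‖ ≤ C * ‖v‖ := by
  set w := A.symm v
  have hv : v = A w := by simp [w]
  have h := hA.inner_complexStructure w (complexStructure n w)
  rw [real_inner_self_eq_norm_sq, norm_complexStructure_apply, ← hv] at h
  have h1 := real_inner_le_norm (complexStructure n v) (A (complexStructure n w))
  have h2 : ‖A (complexStructure n w)‖ ≤ C * ‖w‖ := by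
    have := (A : PhaseSpace n →L[ℝ] PhaseSpace n).le_of_opNorm_le hC (complexStructure n w)
    rwa [norm_complexStructure_apply] at this
  rw [h, norm_complexStructure_apply] at h1
  have h3 : ‖w‖ * ‖w‖ ≤ C * ‖v‖ * ‖w‖ := by
    nlinarith [mul_le_mul_of_nonneg_left h2 (norm_nonneg v)]
  rcases (norm_nonneg w).eq_or_lt with h0 | h0
  · rw [← h0]
    exact mul_nonneg ((norm_nonneg _).trans hC) (norm_nonneg v)
  · exact le_of_mul_le_mul_right h3 h0

lemma isSymplectic_trans {A B : PhaseSpace n ≃L[ℝ] PhaseSpace n} (hA : IsSymplectic A)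
    (hB : IsSymplectic B) : IsSymplectic (A.trans B) := by
  have : ((A.trans B : PhaseSpace n ≃L[ℝ] PhaseSpace n) : PhaseSpace n →L[ℝ] PhaseSpace n) =
      (B : PhaseSpace n →L[ℝ] PhaseSpace n) * (A : PhaseSpace n →L[ℝ] PhaseSpace n) := rfl
  rw [IsSymplectic, this, map_mul]
  exact mul_mem hB hA

lemma isSymplectic_cayleyRotation (t : ℝ) :
    IsSymplectic (cayleyRotation (complexStructure n) complexStructure_sq t) := by
  have h : (Matrix.toEuclideanCLM (n := Fin n ⊕ Fin n) (𝕜 := ℝ)).symm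
      (cayleyRotation (complexStructure n) complexStructure_sq t) =
      ((1 - t ^ 2) / (1 + t ^ 2)) • 1 + (2 * t / (1 + t ^ 2)) • Matrix.J (Fin n) ℝ := by
    apply EquivLike.injective (Matrix.toEuclideanCLM (n := Fin n ⊕ Fin n) (𝕜 := ℝ))
    rw [StarAlgEquiv.apply_symm_apply, coe_cayleyRotation, map_add, map_smul, map_smul, map_one]
    rfl
  have ht : 1 + t ^ 2 ≠ 0 := by positivity
  rw [IsSymplectic, h, SymplecticGroup.mem_iff, Matrix.transpose_add, Matrix.transpose_smul,
    Matrix.transpose_smul, Matrix.J_transpose, Matrix.transpose_one]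
  simp only [add_mul, mul_add, smul_mul_assoc, mul_smul_comm, one_mul, mul_one, mul_neg,
    Matrix.J_squared, neg_mul, smul_neg]
  match_scalars <;> field_simp <;> ring

lemma isSymplectic_block {ψ : ℤ → (PhaseSpace n ≃L[ℝ] PhaseSpace n)}
    (hψ : ∀ j, IsSymplectic (ψ j)) (j : ℤ) (m : ℕ) : IsSymplectic (block ψ j m) := by
  induction m with
  | zero =>
    have : ((block ψ j 0 : PhaseSpace n ≃L[ℝ] PhaseSpace n) :
      PhaseSpace n →L[ℝ] PhaseSpace n) = 1 := rfl
    rw [IsSymplectic, this, map_one]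
    exact one_mem _
  | succ m ih => exact isSymplectic_trans ih (hψ _)

/-- A map preserving the symplectic form does not contract the whole space. -/
lemma one_le_of_preserves_form (hn : 0 < n) {A : PhaseSpace n → PhaseSpace n}
    (hA : ∀ x y, inner ℝ (complexStructure n (A x)) (A y) = inner ℝ (complexStructure n x) y)
    {c : ℝ} (hc : 0 ≤ c) (h : ∀ v, ‖A v‖ ≤ c * ‖v‖) : 1 ≤ c := by
  obtain ⟨v, hv⟩ : ∃ v : PhaseSpace n, v ≠ 0 :=
    ⟨EuclideanSpace.single (Sum.inl ⟨0, hn⟩) 1, by simp⟩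
  have hpos : 0 < ‖v‖ := norm_pos_iff.2 hv
  have h1 := hA v (complexStructure n v)
  rw [real_inner_self_eq_norm_sq, norm_complexStructure_apply] at h1
  have h2 := real_inner_le_norm (complexStructure n (A v)) (A (complexStructure n v))
  have h3 := h (complexStructure n v)
  rw [h1, norm_complexStructure_apply] at h2
  rw [norm_complexStructure_apply] at h3
  by_contra! hlt
  have h4 : ‖A v‖ * ‖A (complexStructure n v)‖ ≤ (c * ‖v‖) * (c * ‖v‖) :=
    mul_le_mul (h v) h3 (norm_nonneg _) (by positivity)
  nlinarith [mul_lt_mul'' hlt hlt hc hc, mul_pos hpos hpos]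

lemma IsSymplectic.symm_inner_complexStructure {A : PhaseSpace n ≃L[ℝ] PhaseSpace n}
    (hA : IsSymplectic A) (x y : PhaseSpace n) :
    inner ℝ (complexStructure n (A.symm x)) (A.symm y) = inner ℝ (complexStructure n x) y := by
  simpa using (hA.inner_complexStructure (A.symm x) (A.symm y)).symm

end Symplectic

end

noncomputable section

/-! ### From uniform hyperbolicity to uniform contraction. -/

section UniformHyperbolicity

lemma restrNorm_nonneg {E : Type*} [NormedAddCommGroup E] [NormedSpace ℝ E] (A : E →L[ℝ] E)
    (W : Submodule ℝ E) : 0 ≤ restrNorm A W :=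
  ContinuousLinearMap.opNorm_nonneg _

lemma inv_le_restrNorm {E : Type*} [NormedAddCommGroup E] [NormedSpace ℝ E] (A : E ≃L[ℝ] E)
    {D : ℝ} (hD : 0 < D) (hA : ∀ v, ‖A.symm v‖ ≤ D * ‖v‖) {W : Submodule ℝ E} (hW : W ≠ ⊥) :
    D⁻¹ ≤ restrNorm (A : E →L[ℝ] E) W := by
  obtain ⟨v, hv, hv0⟩ := W.ne_bot_iff.1 hW
  have hpos : 0 < ‖v‖ := norm_pos_iff.2 hv0
  have h1 := norm_apply_le_restrNorm (A : E →L[ℝ] E) hv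
  have h2 := hA (A v)
  rw [A.symm_apply_apply] at h2
  rw [inv_le_iff_one_le_mul₀' hD]
  refine le_of_mul_le_mul_right ?_ hpos
  rw [one_mul, mul_assoc]
  exact h2.trans (mul_le_mul_of_nonneg_left h1 hD.le)

variable {Λ : Type*} {n : ℕ}

lemma norm_sub_comp_cayleyRotation_le {A : PhaseSpace n ≃L[ℝ] PhaseSpace n} {C : ℝ}
    (hC : ‖(A : PhaseSpace n →L[ℝ] PhaseSpace n)‖ ≤ C) {t r : ℝ} (ht : |t| ≤ r) (hr : r ≤ 1) :
    ‖(A : PhaseSpace n →L[ℝ] PhaseSpace n) -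
      ((cayleyRotation (complexStructure n) complexStructure_sq t).trans A :
        PhaseSpace n ≃L[ℝ] PhaseSpace n)‖ ≤ C * (4 * r) := by
  have hC0 : 0 ≤ C := (norm_nonneg _).trans hC
  have hr0 : 0 ≤ r := (abs_nonneg t).trans ht
  refine ContinuousLinearMap.opNorm_le_bound _ (by positivity) fun v => ?_
  have ht1 : 1 + t ^ 2 ≠ 0 := by positivity
  have hv : ((A : PhaseSpace n →L[ℝ] PhaseSpace n) -
      ((cayleyRotation (complexStructure n) complexStructure_sq t).trans A :
        PhaseSpace n ≃L[ℝ] PhaseSpace n)) v =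
      (A : PhaseSpace n →L[ℝ] PhaseSpace n)
        ((2 * t / (1 + t ^ 2)) • (t • v - complexStructure n v)) := by
    have : (2 * t / (1 + t ^ 2)) • (t • v - complexStructure n v) =
        v - cayleyRotation (complexStructure n) complexStructure_sq t v := by
      rw [cayleyRotation_apply]
      match_scalars <;> field_simp
      ring
    rw [this, map_sub]
    rfl
  rw [hv, mul_assoc]
  refine (ContinuousLinearMap.le_of_opNorm_le _ hC _).trans
    (mul_le_mul_of_nonneg_left ?_ hC0)
  have h1 : ‖t • v - complexStructure n v‖ ≤ 2 * ‖v‖ := by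
    refine (norm_sub_le _ _).trans ?_
    rw [norm_smul, norm_complexStructure_apply, Real.norm_eq_abs]
    nlinarith [norm_nonneg v]
  have h2 : |2 * t / (1 + t ^ 2)| ≤ 2 * r := by
    rw [abs_div, abs_mul, abs_two, abs_of_pos (by positivity : (0 : ℝ) < 1 + t ^ 2)]
    refine (div_le_self (by positivity) (by nlinarith [sq_nonneg t])).trans ?_
    linarith
  rw [norm_smul, Real.norm_eq_abs]
  calc _ ≤ (2 * r) * (2 * ‖v‖) := mul_le_mul h2 h1 (norm_nonneg _) (by positivity)
    _ = _ := by ring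

lemma IsUniformlyHyperbolicFamily.exists_hyperbolic_twists
    {ψ : Λ → ℤ → (PhaseSpace n ≃L[ℝ] PhaseSpace n)} (hunif : IsUniformlyHyperbolicFamily ψ)
    (hψ : IsPeriodicSymplecticFamily ψ) {C : ℝ} (hC0 : 0 < C)
    (hC : ∀ α j, ‖(ψ α j : PhaseSpace n →L[ℝ] PhaseSpace n)‖ ≤ C) :
    ∃ r : ℝ, 0 < r ∧ r ≤ 1 ∧ ∀ t : ℝ, |t| ≤ r → ∀ α, IsHyperbolicSeq fun i =>
      (cayleyRotation (complexStructure n) complexStructure_sq t).trans (ψ α i) := by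
  obtain ⟨ε, hε, hunif⟩ := hunif
  -- The twist moves each map by at most `4Cr ≤ ε / 2`, leaving room for the supremum to stay
  -- strictly below `ε`.
  refine ⟨min 1 (ε / (8 * C)), by positivity, min_le_left _ _, fun t ht => ?_⟩
  -- The rotation is invertible and independent of the index, so twisting preserves the set of
  -- periods.
  have hper : ∀ (α : Λ) (p : ℕ), (∀ j : ℤ,
      (cayleyRotation (complexStructure n) complexStructure_sq t).trans (ψ α (j + p)) =
        (cayleyRotation (complexStructure n) complexStructure_sq t).trans (ψ α j)) ↔
      ∀ j : ℤ, ψ α (j + p) = ψ α j := by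
    refine fun α p => forall_congr' fun j => ⟨fun h => ?_, fun h => by rw [h]⟩
    ext1
    funext v
    have := congrArg (fun T : PhaseSpace n ≃L[ℝ] PhaseSpace n =>
      T ((cayleyRotation (complexStructure n) complexStructure_sq t).symm v)) h
    simpa using this
  refine hunif (fun α i =>
    (cayleyRotation (complexStructure n) complexStructure_sq t).trans (ψ α i)) ⟨?_, ?_⟩ ?_ ?_
  · intro α
    obtain ⟨p, hp, h⟩ := hψ.1 α
    exact ⟨p, hp, (hper α p).2 h⟩
  · exact fun α j => isSymplectic_trans (isSymplectic_cayleyRotation t) (hψ.2 α j)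
  · intro α
    simp only [minPeriod, hper]
  · refine lt_of_le_of_lt (b := ENNReal.ofReal (ε / 2)) ?_
      ((ENNReal.ofReal_lt_ofReal_iff hε).2 (half_lt_self hε))
    refine iSup₂_le fun α j => ?_
    rw [← ofReal_norm]
    refine ENNReal.ofReal_le_ofReal ((norm_sub_comp_cayleyRotation_le (hC α j) ht
      (min_le_left _ _)).trans ?_)
    calc C * (4 * min 1 (ε / (8 * C))) ≤ C * (4 * (ε / (8 * C))) := by
          gcongr; exact min_le_right _ _
      _ = ε / 2 := by field_simp; ring

/-- A bounded uniformly hyperbolic symplectic family contracts its stable subspaces and, in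
backward time, its unstable subspaces at a uniform rate. -/
lemma IsUniformlyHyperbolicFamily.exists_uniform_contraction
    {ψ : Λ → ℤ → (PhaseSpace n ≃L[ℝ] PhaseSpace n)} (hunif : IsUniformlyHyperbolicFamily ψ)
    (hψ : IsPeriodicSymplecticFamily ψ) {C : ℝ} (hC0 : 0 < C)
    (hC : ∀ α j, ‖(ψ α j : PhaseSpace n →L[ℝ] PhaseSpace n)‖ ≤ C) :
    ∃ m : ℕ, 0 < m ∧ ∀ (α : Λ) (j : ℤ),
      restrNorm (block (ψ α) j m : PhaseSpace n →L[ℝ] PhaseSpace n)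
        (stableSubspace (ψ α) j) ≤ 1 / 2 ∧
      restrNorm ((block (ψ α) j m).symm : PhaseSpace n →L[ℝ] PhaseSpace n)
        (unstableSubspace (ψ α) (j + m)) ≤ 1 / 2 := by
  obtain ⟨r, hr, hr1, hhyp⟩ := hunif.exists_hyperbolic_twists hψ hC0 hC
  -- Dominates both end coefficients `C² / r²` and `1 / r²`, and is at least one since `r ≤ 1`.
  set Q : ℝ := (C ^ 2 + 1) / r ^ 2
  have hQ : 1 ≤ Q := by
    rw [one_le_div (by positivity)]
    nlinarith [sq_nonneg C]
  have hQ0 : 0 < Q := by linarith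
  have hwin : ∀ (α : Λ) (j : ℤ) (M : ℕ) (v : PhaseSpace n),
      ∑ k ∈ Finset.range (M + 1), ‖block (ψ α) j k v‖ ^ 2 ≤
        Q * (‖v‖ ^ 2 + ‖block (ψ α) j M v‖ ^ 2) := by
    intro α j M v
    have h := sum_sq_norm_block_le complexStructure_skew complexStructure_sq
      (fun i => (hψ.2 α i).inner_complexStructure) (hψ.1 α)
      (fun i => norm_symm_apply_le (hψ.2 α i) (hC α i)) hr hr1 (fun t ht => hhyp t ht α) j M v
    rw [div_mul_eq_mul_div, le_div_iff₀' (by positivity)]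
    refine h.trans ?_
    nlinarith [sq_nonneg ‖v‖, mul_nonneg (sq_nonneg C) (sq_nonneg ‖block (ψ α) j M v‖)]
  -- The decay concerns squared norms, hence the target `(1 / 2) ^ 2`.
  obtain ⟨m, hm0, hm⟩ : ∃ m : ℕ, 0 < m ∧ Q * (1 - Q⁻¹) ^ m ≤ (1 / 2) ^ 2 := by
    have hlim : Filter.Tendsto (fun m : ℕ => Q * (1 - Q⁻¹) ^ m) Filter.atTop (nhds (Q * 0)) :=
      (tendsto_pow_atTop_nhds_zero_of_lt_one (by linarith [inv_le_one_of_one_le₀ hQ])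
        (by linarith [inv_pos.2 hQ0])).const_mul Q
    rw [mul_zero] at hlim
    exact ((Filter.eventually_gt_atTop 0).and
      (hlim.eventually_le_const (by norm_num))).exists
  refine ⟨m, hm0, fun α j => ⟨?_, ?_⟩⟩ <;> refine restrNorm_le_of_sq_le (by norm_num) fun v hv => ?_
  · exact (sq_norm_block_le_of_mem_stableSubspace hQ (hwin α) hv m).trans
      (mul_le_mul_of_nonneg_right hm (sq_nonneg _))
  · have h := sq_norm_block_symm_le_of_mem_unstableSubspace hQ (hwin α) hv m
    rw [add_sub_cancel_right] at h
    exact h.trans (mul_le_mul_of_nonneg_right hm (sq_nonneg _))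

end UniformHyperbolicity

end

/-! ### The main theorem. -/

theorem mainTheorem8 {Λ : Type*} (n : ℕ) (hn : 0 < n)
    (ψ : Λ → ℤ → (PhaseSpace n ≃L[ℝ] PhaseSpace n))
    (hψ : IsPeriodicSymplecticFamily ψ)
    (hbdd : ∃ C : ℝ, ∀ α j, ‖(ψ α j : PhaseSpace n →L[ℝ] PhaseSpace n)‖ ≤ C)
    (hunif : IsUniformlyHyperbolicFamily ψ) :
    ∃ K : ℝ, 0 < K ∧ ∃ m : ℕ, 0 < m ∧ ∃ l : ℝ, 0 < l ∧ l < 1 ∧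
      (∀ α : Λ, m ≤ minPeriod (ψ α) →
        ∏ j ∈ Finset.range (minPeriod (ψ α) / m),
            restrNorm (block (ψ α) (m * j) m : PhaseSpace n →L[ℝ] PhaseSpace n)
              (stableSubspace (ψ α) (m * j))
          ≤ K * l ^ (minPeriod (ψ α) / m) ∧
        ∏ j ∈ Finset.range (minPeriod (ψ α) / m),
            restrNorm ((block (ψ α) (m * j) m).symm : PhaseSpace n →L[ℝ] PhaseSpace n)
              (unstableSubspace (ψ α) (m * (j + 1)))
          ≤ K * l ^ (minPeriod (ψ α) / m)) ∧
      (∀ (α : Λ) (j : ℤ),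
        restrNorm (block (ψ α) j m : PhaseSpace n →L[ℝ] PhaseSpace n)
            (stableSubspace (ψ α) j) *
          restrNorm ((block (ψ α) j m).symm : PhaseSpace n →L[ℝ] PhaseSpace n)
            (unstableSubspace (ψ α) (j + m)) ≤ l) ∧
      (∀ α : Λ,
        Filter.limsup (fun N : ℕ => (1 / (N : ℝ)) * ∑ j ∈ Finset.range N,
            Real.log (restrNorm (block (ψ α) (m * j) m : PhaseSpace n →L[ℝ] PhaseSpace n)
              (stableSubspace (ψ α) (m * j)))) Filter.atTop < 0 ∧
        Filter.limsup (fun N : ℕ => (1 / (N : ℝ)) * ∑ j ∈ Finset.range N,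
            Real.log (restrNorm ((block (ψ α) (m * j) m).symm :
                PhaseSpace n →L[ℝ] PhaseSpace n)
              (unstableSubspace (ψ α) (m * (j + 1))))) Filter.atTop < 0) := by
  obtain ⟨C₀, hC₀⟩ := hbdd
  set C := max C₀ 1
  have hC0 : 0 < C := lt_max_of_lt_right one_pos
  have hC : ∀ α j, ‖(ψ α j : PhaseSpace n →L[ℝ] PhaseSpace n)‖ ≤ C :=
    fun α j => (hC₀ α j).trans (le_max_left _ _)
  obtain ⟨m, hm, hcontr⟩ := hunif.exists_uniform_contraction hψ hC0 hC
  have hs := fun α j => (hcontr α j).1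
  have hu : ∀ (α : Λ) (j : ℕ),
      restrNorm ((block (ψ α) (m * j) m).symm : PhaseSpace n →L[ℝ] PhaseSpace n)
        (unstableSubspace (ψ α) (m * (j + 1))) ≤ 1 / 2 := by
    intro α j
    rw [mul_add, mul_one]
    exact (hcontr α _).2
  have hhyp : ∀ α, IsHyperbolicSeq (ψ α) := by
    obtain ⟨ε, hε, h⟩ := hunif
    refine h ψ hψ (fun _ => rfl) (lt_of_le_of_lt (iSup₂_le fun α j => ?_)
      (ENNReal.ofReal_pos.2 hε))
    rw [sub_self, ← ofReal_norm, norm_zero, ENNReal.ofReal_zero]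
  -- Otherwise the unstable subspace is everything, and a symplectic inverse block would contract
  -- the whole space by `1/2`. Nontriviality is needed for the lower bound `C⁻ᵐ` on the restricted
  -- norms.
  have hsne : ∀ α j, stableSubspace (ψ α) j ≠ ⊥ := by
    intro α j hbot
    have htop := hhyp α j
    rw [hbot] at htop
    replace htop := eq_top_of_bot_isCompl htop
    have h := (hcontr α (j - m)).2
    rw [sub_add_cancel, htop] at h
    have h1 := one_le_of_preserves_form hn
      (isSymplectic_block (hψ.2 α) (j - m) m).symm_inner_complexStructure
      (by norm_num : (0 : ℝ) ≤ 1 / 2) fun v =>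
        (norm_apply_le_restrNorm _ Submodule.mem_top).trans
          (mul_le_mul_of_nonneg_right h (norm_nonneg v))
    norm_num at h1
  have hune : ∀ α j, unstableSubspace (ψ α) j ≠ ⊥ := by
    intro α j hbot
    have htop := hhyp α j
    rw [hbot] at htop
    replace htop := eq_top_of_isCompl_bot htop
    have h := hs α j
    rw [htop] at h
    have h1 := one_le_of_preserves_form hn
      (isSymplectic_block (hψ.2 α) j m).inner_complexStructure
      (by norm_num : (0 : ℝ) ≤ 1 / 2) fun v =>
        (norm_apply_le_restrNorm _ Submodule.mem_top).trans
          (mul_le_mul_of_nonneg_right h (norm_nonneg v))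
    norm_num at h1
  refine ⟨1, one_pos, m, hm, 1 / 2, by norm_num, by norm_num, fun α _ => ⟨?_, ?_⟩,
    fun α j => ?_, fun α => ⟨?_, ?_⟩⟩
  · rw [one_mul]
    simpa using Finset.prod_le_prod (s := Finset.range (minPeriod (ψ α) / m))
      (fun _ _ => restrNorm_nonneg _ _) fun (j : ℕ) _ => hs α _
  · rw [one_mul]
    simpa using Finset.prod_le_prod (s := Finset.range (minPeriod (ψ α) / m))
      (fun _ _ => restrNorm_nonneg _ _) fun (j : ℕ) _ => hu α j
  · calc _ ≤ (1 / 2 : ℝ) * (1 / 2) :=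
        mul_le_mul (hs α j) (hcontr α j).2 (restrNorm_nonneg _ _) (by norm_num)
      _ ≤ 1 / 2 := by norm_num
  · exact limsup_average_log_neg (b := (C ^ m)⁻¹) (by positivity) (by norm_num : (1 / 2 : ℝ) < 1)
      (fun j => inv_le_restrNorm _ (by positivity) (norm_block_symm_le hC0.le
        (fun i => norm_symm_apply_le (hψ.2 α i) (hC α i)) _ m) (hsne α _))
      (fun j => hs α _)
  · refine limsup_average_log_neg (b := (C ^ m)⁻¹) (by positivity)
      (by norm_num : (1 / 2 : ℝ) < 1) (fun j => ?_) (fun j => hu α j)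
    refine inv_le_restrNorm (block (ψ α) (m * j) m).symm (by positivity) (fun v => ?_) (hune α _)
    exact norm_block_le hC0.le
      (fun i => ContinuousLinearMap.le_of_opNorm_le _ (hC α i)) (m * j) m v
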